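/- Let $(V,Y,\mathbf 1)$ be a vertex algebra over $\mathbb C$ with modes $Y(v,x)=\sum_{n\in\mathbb Z}v_n x^{-n-1}$, and suppose that it is $\mathbb C$-graded: $V=\bigoplus_{\lambda\in\mathbb C}V_\lambda$, $\mathbf 1\in V_0$, and $v_nV_\lambda\subseteq V_{\lambda+\gamma-n-1}$ for $v\in V_\gamma$, $n\in\mathbb Z$; write $|v|=\lambda$ for $v\in V_\lambda$. Let $\Omega(V)$ be the set of all $v\in V$ such that, whenever $u\in V_\gamma$, $n\in\mathbb Z$ and $u_nv\neq0$, either $n=\gamma-1$ or $n<\operatorname{Re}(\gamma)-1$. Suppose that $V$ is an $\Omega$-generated $\mathbb C_{Re>0}$-graded vertex algebra, i.e. that $V$ is spanned by the elements $v^k_{n_k}\cdots v^1_{n_1}u^0$ with $k\ge 0$, $v^j\in V$, $n_j\in\mathbb Z$, $u^0\in\Omega(V)$, and that the degree $\deg(v^k_{n_k}\cdots v^1_{n_1}u^0)=\sum_j(|v^j|-n_j-1)$ (for homogeneous $v^j$) is well defined, in the sense that the sum of the spaces $V(d)$, $d\in\mathbb C$, spanned by the elements of this form of degree $d$, is direct.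 For $r\in\mathbb C$ let $V^r$ be the span of the homogeneous $v$ with $|v|-\lceil\operatorname{Re}|v|\rceil=r$. Let $\circ$ and $*$ be the bilinear products on $V$ given, for homogeneous $u\in V^r$ and $v\in V$, by $$u\circ v=\operatorname{Res}_z\frac{(1+z)^{\lceil\operatorname{Re}|u|\rceil+\delta_{r,0}-1}}{z^{1+\delta_{r,0}}}Y(u,z)v,\qquad u*v=\delta_{r,0}\operatorname{Res}_z\frac{(1+z)^{|u|}}{z}Y(u,z)v,$$ let $O(V)$ be the span of all $u\circ v$ with $u,v\in V$, let $A(V)=V/O(V)$, and put $$F_tA(V)=\Big(\bigoplus_{j=0}^tV_j+O(V)\Big)/O(V)\quad(t\in\mathbb N),\qquad F_{-1}A(V)=0,\qquad grA(V)=\bigoplus_{t\ge0}F_tA(V)/F_{t-1}A(V).$$ Assume that $V^0=\bigoplus_{n=0}^\infty V_n$. Then $*$ induces on $A(V)$ a well-defined associative product with unit $\mathbf 1+O(V)$; the spaces $F_tA(V)$ form an increasing exhaustive filtration of $A(V)$, which is multiplicative, i.e. $F_sA(V)*F_tA(V)\subseteq F_{s+t}A(V)$ for all $s,t\in\mathbb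 N$; and the induced product on $grA(V)$, under which the classes of $a\in F_sA(V)$ and $b\in F_tA(V)$ have as product the class of $a*b$ in $F_{s+t}A(V)/F_{s+t-1}A(V)$, is well defined and makes $grA(V)$ a commutative associative algebra, with unit the class of $\mathbf 1$. -/

import Mathlib

open scoped DirectSum

/-- A vertex algebra over `ℂ`. The state-field correspondence `v ↦ Y(v, x) = ∑ vₙ x^{-n-1}` takes
values in Mathlib's `VertexOperator`s, i.e. linear maps `V → V((x))`, so that the lower truncation
condition is part of the type. The Jacobi identity is stated as the equality of the coefficients of
`x₀^{-l-1} x₁^{-m-1} x₂^{-n-1}`; all three sums are finite by lower truncation. -/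
structure VertexAlgebra (V : Type*) [AddCommGroup V] [Module ℂ V] where
  /-- The state-field correspondence. -/
  Y : V →ₗ[ℂ] VertexOperator ℂ V
  /-- The vacuum vector. -/
  vac : V
  /-- `Y(𝟏, x)` is the identity. -/
  vacuum : ∀ (n : ℤ) (w : V), VertexOperator.ncoeff (Y vac) n w = if n = -1 then w else 0
  /-- `Y(v, x)𝟏` has no negative powers of `x`. -/
  creation_nonneg : ∀ (v : V) (n : ℤ), 0 ≤ n → VertexOperator.ncoeff (Y v) n vac = 0
  /-- The constant term of `Y(v, x)𝟏` is `v`. -/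
  creation_neg_one : ∀ v : V, VertexOperator.ncoeff (Y v) (-1) vac = v
  /-- The Jacobi identity. -/
  jacobi : ∀ (u v w : V) (l m n : ℤ),
    (∑ᶠ i : ℕ, ((-1 : ℤ) ^ i * Ring.choose l i) •
        VertexOperator.ncoeff (Y u) (m + l - i) (VertexOperator.ncoeff (Y v) (n + i) w))
      - (∑ᶠ i : ℕ, (((-1 : ℤˣ) ^ l : ℤˣ) * ((-1 : ℤ) ^ i * Ring.choose l i)) •
        VertexOperator.ncoeff (Y v) (n + l - i) (VertexOperator.ncoeff (Y u) (m + i) w))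
      = ∑ᶠ i : ℕ, (Ring.choose m i : ℤ) •
        VertexOperator.ncoeff (Y (VertexOperator.ncoeff (Y u) (l + i) v)) (m + n - i) w

namespace VertexAlgebra

variable {V : Type*} [AddCommGroup V] [Module ℂ V] (A : VertexAlgebra V)

/-- The mode `uₙ ∈ End V`, the coefficient of `x^{-n-1}` in `Y(u, x)`. -/
noncomputable def mode (u : V) (n : ℤ) : V →ₗ[ℂ] V := VertexOperator.ncoeff (A.Y u) n

theorem mode_add (u u' v : V) (n : ℤ) :
    A.mode (u + u') n v = A.mode u n v + A.mode u' n v := by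
  simp [mode]

theorem mode_smul (c : ℂ) (u v : V) (n : ℤ) :
    A.mode (c • u) n v = c • A.mode u n v := by
  simp [mode]

/-- Lower truncation. -/
theorem exists_mode_eq_zero (u v : V) : ∃ N : ℤ, ∀ n : ℤ, N ≤ n → A.mode u n v = 0 := by
  refine ⟨-(HahnSeries.order ((HahnModule.of ℂ).symm (A.Y u v))), fun n hn => ?_⟩
  exact VertexOperator.ncoeff_eq_zero_of_lt_order _ _ _ (by lia)

theorem finite_support_mode (a b : ℤ) (u v : V) :
    (Function.support fun i : ℕ => Ring.choose a i • A.mode u (i - b) v).Finite := by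
  obtain ⟨N, hN⟩ := A.exists_mode_eq_zero u v
  refine (Set.finite_lt_nat (N + b).toNat).subset fun i hi => ?_
  by_contra h
  apply hi
  simp only [Set.mem_ofPred_eq, not_lt] at h
  simp [hN (i - b) (by lia)]

/-- The residue `Res_z (1 + z)^a z^{-b} Y(u, z) v = ∑_{i ≥ 0} (a choose i) u_{i-b} v`, as a bilinear
map in `(u, v)`. -/
noncomputable def res (a b : ℤ) : V →ₗ[ℂ] V →ₗ[ℂ] V :=
  LinearMap.mk₂ ℂ (fun u v => ∑ᶠ i : ℕ, Ring.choose a i • A.mode u (i - b) v)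
    (fun u u' v => by
      rw [← finsum_add_distrib (A.finite_support_mode a b u v) (A.finite_support_mode a b u' v)]
      simp only [mode_add, smul_add])
    (fun c u v => by
      rw [smul_finsum' c (A.finite_support_mode a b u v)]
      simp only [mode_smul, smul_comm c])
    (fun u v v' => by
      rw [← finsum_add_distrib (A.finite_support_mode a b u v) (A.finite_support_mode a b u v')]
      simp only [map_add, smul_add])
    (fun c u v => by
      rw [smul_finsum' c (A.finite_support_mode a b u v)]
      simp only [map_smul, smul_comm c])

end VertexAlgebra

/-- A `ℂ`-graded vertex algebra: `V = ⨁_{lam ∈ ℂ} V_lam` with `𝟏 ∈ V_0` and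
`vₙ V_lam ⊆ V_{lam + gam - n - 1}` for `v ∈ V_gam`. -/
structure CGradedVertexAlgebra (V : Type*) [AddCommGroup V] [Module ℂ V] extends
    VertexAlgebra V where
  /-- The weight spaces. -/
  wt : ℂ → Submodule ℂ V
  isInternal : DirectSum.IsInternal wt
  vac_mem : vac ∈ wt 0
  mode_mem : ∀ (gam lam : ℂ) (n : ℤ) (v w : V), v ∈ wt gam → w ∈ wt lam →
    toVertexAlgebra.mode v n w ∈ wt (lam + gam - n - 1)

namespace CGradedVertexAlgebra

variable {V : Type*} [AddCommGroup V] [Module ℂ V] (A : CGradedVertexAlgebra V)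

/-- `Ω(V)`, the vectors annihilated by all modes that lower the real part of the weight. -/
def Omega : Set V :=
  {v | ∀ (gam : ℂ) (u : V) (n : ℤ), u ∈ A.wt gam → A.mode u n v ≠ 0 →
    (n : ℂ) = gam - 1 ∨ (n : ℝ) < gam.re - 1}

/-- Elements of the form `v^k_{n_k} ⋯ v^1_{n_1} u⁰` with `u⁰ ∈ Ω(V)`. -/
inductive OmegaWord : V → Prop
  | base (u : V) (hu : u ∈ A.Omega) : OmegaWord u
  | step (v w : V) (n : ℤ) (hw : OmegaWord w) : OmegaWord (A.mode v n w)

/-- `V` is `Ω`-generated. -/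
def IsOmegaGenerated : Prop := Submodule.span ℂ {v | A.OmegaWord v} = ⊤

/-- `OmegaWordDeg d x`: `x = v^k_{n_k} ⋯ v^1_{n_1} u⁰` with `u⁰ ∈ Ω(V)`, with homogeneous `v^j`, and
with `d = ∑_j (|v^j| - n_j - 1)`. -/
inductive OmegaWordDeg : ℂ → V → Prop
  | base (u : V) (hu : u ∈ A.Omega) : OmegaWordDeg 0 u
  | step (d gam : ℂ) (v w : V) (n : ℤ) (hv : v ∈ A.wt gam) (hw : OmegaWordDeg d w) :
      OmegaWordDeg (d + (gam - n - 1)) (A.mode v n w)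

/-- The space `V(d)` of elements of degree `d`. -/
def degSpace (d : ℂ) : Submodule ℂ V := Submodule.span ℂ {x | A.OmegaWordDeg d x}

/-- The degree is well defined: the sum of the spaces `V(d)`, `d ∈ ℂ`, is direct. -/
def DegreeWellDefined : Prop := iSupIndep A.degSpace

/-- `V` is an `Ω`-generated `ℂ_{Re>0}`-graded vertex algebra. -/
def IsOmegaGeneratedReGraded : Prop := A.IsOmegaGenerated ∧ A.DegreeWellDefined

/-- `V^r`, the span of the homogeneous `v` with `|v| - ⌈Re |v|⌉ = r`. -/
def part (r : ℂ) : Submodule ℂ V :=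
  Submodule.span ℂ {v | ∃ lam : ℂ, v ∈ A.wt lam ∧ r = lam - (⌈lam.re⌉ : ℤ)}

/-- The bilinear extension to `V` of products `u, v ↦ f lam u v` given for `u ∈ V_lam`, `v ∈ V`. -/
noncomputable def extend (f : ℂ → V →ₗ[ℂ] V →ₗ[ℂ] V) : V →ₗ[ℂ] V →ₗ[ℂ] V :=
  DirectSum.toModule ℂ ℂ (V →ₗ[ℂ] V) (fun lam => (f lam) ∘ₗ (A.wt lam).subtype) ∘ₗ
    (LinearEquiv.ofBijective (DirectSum.coeLinearMap A.wt) A.isInternal).symm.toLinearMap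

open Classical in
/-- `δ_{r,0}` for `r = lam - ⌈Re lam⌉`. -/
noncomputable def delta (lam : ℂ) : ℤ := if lam - (⌈lam.re⌉ : ℤ) = 0 then 1 else 0

/-- The product `∘`: for `u ∈ V_lam` it is `Res_z (1+z)^{⌈Re lam⌉+δ-1} z^{-(1+δ)} Y(u,z)v`. -/
noncomputable def circ : V →ₗ[ℂ] V →ₗ[ℂ] V :=
  A.extend fun lam => A.res (⌈lam.re⌉ + delta lam - 1) (1 + delta lam)

/-- The product `*`: for `u ∈ V_lam` it is `δ Res_z (1+z)^{lam} z^{-1} Y(u,z)v`; where `δ ≠ 0` the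
weight `lam` is the integer `⌈Re lam⌉`. -/
noncomputable def star : V →ₗ[ℂ] V →ₗ[ℂ] V :=
  A.extend fun lam => delta lam • A.res ⌈lam.re⌉ 1

/-- `O(V)`, the span of all `u ∘ v`. -/
def zhuO : Submodule ℂ V := Submodule.span ℂ {x | ∃ u v : V, x = A.circ u v}

/-- The vector space `A(V) = V / O(V)`. -/
abbrev Zhu : Type _ := V ⧸ A.zhuO

/-- The class `[v] = v + O(V)`. -/
abbrev cls (v : V) : A.Zhu := A.zhuO.mkQ v

/-- `F_t A(V) = (⨁_{j=0}^t V_j + O(V)) / O(V)`. -/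
def fil (t : ℕ) : Submodule ℂ A.Zhu := (⨆ (j : ℕ) (_ : j ≤ t), A.wt (j : ℂ)).map A.zhuO.mkQ

/-- `F_{t-1} A(V)`, with `F_{-1} A(V) = 0`. -/
def filPred : ℕ → Submodule ℂ A.Zhu
  | 0 => ⊥
  | t + 1 => A.fil t

/-- `gr_t A(V) = F_t A(V) / F_{t-1} A(V)`. -/
abbrev grPiece (t : ℕ) : Type _ := A.fil t ⧸ (A.filPred t).comap (A.fil t).subtype

/-- `gr A(V) = ⨁_t gr_t A(V)`. -/
abbrev gr : Type _ := ⨁ t : ℕ, A.grPiece t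

/-- The class in `gr_t A(V) ⊆ gr A(V)` of an element of `F_t A(V)`. -/
noncomputable def symb (t : ℕ) (a : A.fil t) : A.gr :=
  DirectSum.lof ℂ ℕ A.grPiece t (((A.filPred t).comap (A.fil t).subtype).mkQ a)

theorem cls_vac_mem : A.cls A.vac ∈ A.fil 0 := by
  refine Submodule.mem_map_of_mem (Submodule.mem_iSup_of_mem 0 (Submodule.mem_iSup_of_mem le_rfl ?_))
  simpa using A.vac_mem

end CGradedVertexAlgebra

/-!
Let `L_u` and `R_v` be the operators `Res_z (1 + z)^{|u|} z^{-1} Y(u, z)` and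
`Res_z (1 + z)^{|v| - 1} z^{-1} Y(v, z)` for vectors of integral weight, and zero for all other
weights, so that `u * v = L_u v`. The commutator formula expresses `[L_u, R_v] w` through residues
of the fields `Y(u_i v, z) w` that lie in `O(V)`, so `L_u` and `R_v` commute modulo `O(V)`; the same
computation shows that both operators preserve `O(V)`. Since `L_u 𝟏 ≡ u` and `R_v 𝟏 ≡ v`, applying
`L_u R_v ≡ R_v L_u` to the vacuum gives `u * v ≡ R_v u`. Hence `O(V)` is a two-sided ideal, the
product is associative modulo `O(V)`, and `u * v - v * u ≡ (L_u - R_u) v`, where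
`L_u - R_u = Res_z (1 + z)^{|u| - 1} Y(u, z)` only involves modes that lower the filtration degree.
-/

section FormalCalculus

open HahnSeries LaurentSeries Finset

section OnePlusPow

variable {R : Type*} [CommRing R]

variable (R) in
/-- The Laurent series `(1 + z)^p z^q`, where `(1 + z)^p` is expanded in nonnegative powers of
`z`. -/
noncomputable def onePlusPow (p q : ℤ) : LaurentSeries R :=
  single q 1 * ofPowerSeries ℤ R (PowerSeries.binomialSeries R p)

theorem onePlusPow_mul_onePlusPow (p q p' q' : ℤ) :
    onePlusPow R p q * onePlusPow R p' q' = onePlusPow R (p + p') (q + q') := by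
  simp only [onePlusPow, PowerSeries.binomialSeries_add, map_mul]
  rw [mul_mul_mul_comm, single_mul_single, one_mul]

theorem coeff_onePlusPow_of_lt {p q n : ℤ} (h : n < q) : (onePlusPow R p q).coeff n = 0 := by
  rw [onePlusPow, coeff_single_mul, one_mul, PowerSeries.coeff_coe, if_pos (by lia)]

theorem coeff_onePlusPow_add_natCast (p q : ℤ) (i : ℕ) :
    (onePlusPow R p q).coeff (q + i) = Ring.choose p i := by
  rw [onePlusPow, coeff_single_mul, one_mul, add_sub_cancel_left, coeff_coe_powerSeries]
  simp

theorem onePlusPow_zero_left (q : ℤ) : onePlusPow R 0 q = single q 1 := by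
  simp [onePlusPow]

theorem onePlusPow_add_one_left (p q : ℤ) :
    onePlusPow R (p + 1) q = onePlusPow R p q + onePlusPow R p (q + 1) := by
  have one_add_z : onePlusPow R 1 0 = onePlusPow R 0 0 + onePlusPow R 0 1 := by
    have h := PowerSeries.binomialSeries_nat (R := ℤ) (A := R) 1
    rw [Nat.cast_one, pow_one] at h
    simp [onePlusPow, h]
  simpa only [mul_add, onePlusPow_mul_onePlusPow, add_zero] using
    congrArg (onePlusPow R p q * ·) one_add_z

theorem natCast_choose_mul_choose_eq (p q : ℤ) (i e : ℕ) :
    (Nat.choose e i * Ring.choose p e : ℤ) =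
      Ring.choose p i * (onePlusPow R (p - i) q).coeff (q + e - i) := by
  rcases lt_or_ge e i with h | h
  · rw [Nat.choose_eq_zero_of_lt h, coeff_onePlusPow_of_lt (by lia)]
    simp
  · have trinomial := congrArg (Int.cast (R := R)) (Ring.choose_smul_choose p h)
    rw [add_sub_assoc, ← Nat.cast_sub h, coeff_onePlusPow_add_natCast]
    exact_mod_cast trinomial

theorem hasseDeriv_onePlusPow (k : ℕ) (p q : ℤ) :
    hasseDeriv R k (onePlusPow R p q) = ∑ ij ∈ antidiagonal k,
      (Ring.choose p ij.1 * Ring.choose q ij.2) • onePlusPow R (p - ij.1) (q - ij.2) := by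
  -- Vandermonde's identity for `n + k = e + q` splits the factor `(n + k).choose k` that the
  -- derivative contributes to the coefficient of `z^n`.
  ext n
  rw [hasseDeriv_coeff, coeff_sum]
  simp only [coeff_smul]
  rcases lt_or_ge (n + k) q with h | h
  · rw [coeff_onePlusPow_of_lt h, smul_zero]
    refine (sum_eq_zero fun ij hij => ?_).symm
    rw [HasAntidiagonal.mem_antidiagonal] at hij
    rw [coeff_onePlusPow_of_lt (by lia), smul_zero]
  · obtain ⟨e, he⟩ : ∃ e : ℕ, n + k = q + e := ⟨(n + k - q).toNat, by lia⟩
    rw [he, coeff_onePlusPow_add_natCast, add_comm q, Ring.add_choose_eq _ (Commute.all _ _),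
      sum_smul]
    refine sum_congr rfl fun ⟨i, j⟩ hij => ?_
    have hn : n = q - j + e - i := by
      rw [HasAntidiagonal.mem_antidiagonal] at hij
      lia
    have h := natCast_choose_mul_choose_eq (R := R) p (q - j) i e
    rw [hn, Ring.choose_natCast]
    simp only [zsmul_eq_mul]
    push_cast at h ⊢
    linear_combination ((Ring.choose q j : ℤ) : R) * h

theorem hasseDeriv_one_onePlusPow (p q : ℤ) :
    hasseDeriv R 1 (onePlusPow R p q) =
      p • onePlusPow R (p - 1) q + q • onePlusPow R p (q - 1) := by
  simp [hasseDeriv_onePlusPow, Nat.antidiagonal_succ, add_comm]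

end OnePlusPow

section VanishesAtHighOrder

variable {R M : Type*} [CommRing R] [AddCommGroup M]

/-- Continuity at `0` of a map on `R((z))` with values in a discrete group, for the `z`-adic
topology: the map kills every Laurent series of sufficiently high order. -/
def VanishesAtHighOrder (T : LaurentSeries R → M) : Prop :=
  ∃ N : ℤ, ∀ f : LaurentSeries R, (∀ n < N, f.coeff n = 0) → T f = 0

namespace VanishesAtHighOrder

variable {S T : LaurentSeries R → M}

theorem sub (hS : VanishesAtHighOrder S) (hT : VanishesAtHighOrder T) :
    VanishesAtHighOrder fun f => S f - T f := by
  obtain ⟨N, hN⟩ := hS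
  obtain ⟨N', hN'⟩ := hT
  refine ⟨max N N', fun f hf => ?_⟩
  simp only [hN f fun n hn => hf n (lt_max_of_lt_left hn),
    hN' f fun n hn => hf n (lt_max_of_lt_right hn), sub_zero]

theorem sum {ι : Type*} (s : Finset ι) {U : ι → LaurentSeries R → M}
    (hU : ∀ i ∈ s, VanishesAtHighOrder (U i)) :
    VanishesAtHighOrder fun f => ∑ i ∈ s, U i f := by
  choose! N hN using hU
  obtain ⟨B, hB⟩ := (s.image N).bddAbove
  refine ⟨B, fun f hf => sum_eq_zero fun i hi => hN i hi f fun n hn => hf n (hn.trans_le ?_)⟩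
  exact hB (mem_coe.2 (mem_image_of_mem N hi))

theorem map {M' F : Type*} [AddCommGroup M'] [FunLike F M M'] [ZeroHomClass F M M']
    (hT : VanishesAtHighOrder T) (φ : F) : VanishesAtHighOrder fun f => φ (T f) := by
  obtain ⟨N, hN⟩ := hT
  exact ⟨N, fun f hf => by simp only [hN f hf, map_zero]⟩

theorem comp_mul_left (hT : VanishesAtHighOrder T) (g : LaurentSeries R) :
    VanishesAtHighOrder fun f => T (g * f) := by
  obtain ⟨N, hN⟩ := hT
  refine ⟨N - g.order, fun f hf => hN _ fun n hn => ?_⟩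
  rw [coeff_mul]
  refine sum_eq_zero fun ij hij => ?_
  rw [Finset.mem_antidiagonal, HahnSeries.mem_support, HahnSeries.mem_support] at hij
  have h₁ : g.order ≤ ij.1 := order_le_of_coeff_ne_zero hij.1
  have h₂ : N - g.order ≤ ij.2 := not_lt.1 fun h => hij.2.1 (hf _ h)
  lia

theorem comp_hasseDeriv (hT : VanishesAtHighOrder T) (k : ℕ) :
    VanishesAtHighOrder fun f => T (hasseDeriv R k f) := by
  obtain ⟨N, hN⟩ := hT
  refine ⟨N + k, fun f hf => hN _ fun n hn => ?_⟩
  rw [hasseDeriv_coeff, hf _ (by lia), smul_zero]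

theorem eq_zero (hT : VanishesAtHighOrder T) (add : ∀ f g, T (f + g) = T f + T g)
    (single : ∀ (n : ℤ) (c : R), T (single n c) = 0) (f : LaurentSeries R) : T f = 0 := by
  obtain ⟨N, hN⟩ := hT
  have peel_leading_term (m : ℤ) (hm : m ≤ N) :
      ∀ f : LaurentSeries R, (∀ n < m, f.coeff n = 0) → T f = 0 := by
    induction m, hm using Int.leInductionDown with
    | base => exact hN
    | pred m _ ih =>
      intro f hf
      rw [← sub_add_cancel f (HahnSeries.single (m - 1) (f.coeff (m - 1))), add, single, add_zero]
      refine ih _ fun n hn => ?_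
      rcases eq_or_ne n (m - 1) with rfl | hne
      · simp
      · rw [coeff_sub, coeff_single_of_ne hne, hf n (by lia), sub_zero]
  exact peel_leading_term (min N f.order) (min_le_left _ _) f fun n hn =>
    coeff_eq_zero_of_lt_order (hn.trans_le (min_le_right _ _))

end VanishesAtHighOrder

end VanishesAtHighOrder

end FormalCalculus

section AssociatedGraded

variable {ι R M : Type*} [CommRing R] [AddCommGroup M] [Module R M]

/-- The degree `t` part of the associated graded module of `F` modulo `G`. No inclusion `G t ≤ F t`
is required: the quotient is by the part of `G t` that lies in `F t`. -/
abbrev AssociatedGraded.Piece (F G : ι → Submodule R M) (t : ι) : Type _ :=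
  F t ⧸ (G t).comap (F t).subtype

/-- The associated graded module of `F` modulo `G`. The usual one of a filtration `F` is the case
where `G t` is the union of the `F s` with `s < t`. -/
abbrev AssociatedGraded (F G : ι → Submodule R M) : Type _ :=
  ⨁ t, AssociatedGraded.Piece F G t

/-- A bilinear product `μ` compatible with two families of submodules in the way that makes it
descend to the associated graded module of `F` modulo `G`. -/
structure IsFilteredProduct [Add ι] (F G : ι → Submodule R M) (μ : M →ₗ[R] M →ₗ[R] M) : Prop where
  mul_mem : ∀ (s t : ι) (a b : M), a ∈ F s → b ∈ F t → μ a b ∈ F (s + t)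
  mul_mem_left : ∀ (s t : ι) (a b : M), a ∈ G s → b ∈ F t → μ a b ∈ G (s + t)
  mul_mem_right : ∀ (s t : ι) (a b : M), a ∈ F s → b ∈ G t → μ a b ∈ G (s + t)

namespace AssociatedGraded

variable {F G : ι → Submodule R M} {μ : M →ₗ[R] M →ₗ[R] M}

/-- The product `F s × F t → F (s + t) / G (s + t)` induced by a filtered product. -/
def filteredMul [Add ι] (hμ : IsFilteredProduct F G μ) (s t : ι) :
    F s →ₗ[R] F t →ₗ[R] Piece F G (s + t) :=
  (LinearMap.mk₂ R
    (fun (a : F s) (b : F t) => (⟨μ a b, hμ.mul_mem s t a b a.2 b.2⟩ : F (s + t)))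
    (fun a a' b => Subtype.ext (by simp)) (fun c a b => Subtype.ext (by simp))
    (fun a b b' => Subtype.ext (by simp)) (fun c a b => Subtype.ext (by simp))).compr₂
    ((G (s + t)).comap (F (s + t)).subtype).mkQ

/-- The product `F s / G s × F t / G t → F (s + t) / G (s + t)` induced by a filtered product. -/
noncomputable def pieceMul [Add ι] (hμ : IsFilteredProduct F G μ) (s t : ι) :
    Piece F G s →ₗ[R] Piece F G t →ₗ[R] Piece F G (s + t) :=
  (((G t).comap (F t).subtype).liftQ
    (((G s).comap (F s).subtype).liftQ (filteredMul hμ s t) fun a ha => LinearMap.ext fun b =>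
      (Submodule.Quotient.mk_eq_zero _).2 (hμ.mul_mem_left s t a b ha b.2)).flip
    fun b hb => LinearMap.ext <| (Submodule.mkQ_surjective _).forall.2 fun a =>
      (Submodule.Quotient.mk_eq_zero _).2 (hμ.mul_mem_right s t a b a.2 hb)).flip

variable [DecidableEq ι]

/-- The product on the associated graded module induced by a filtered product. -/
noncomputable def mul [Add ι] (hμ : IsFilteredProduct F G μ) :
    AssociatedGraded F G →ₗ[R] AssociatedGraded F G →ₗ[R] AssociatedGraded F G :=
  DirectSum.toModule R ι _ fun s => (DirectSum.toModule R ι _ fun t =>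
    ((pieceMul hμ s t).compr₂ (DirectSum.lof R ι (Piece F G) (s + t))).flip).flip

variable (F G) in
/-- The symbol map: the class of an element of `F t` in the degree `t` part. -/
noncomputable def symbol (t : ι) : F t →ₗ[R] AssociatedGraded F G :=
  DirectSum.lof R ι (Piece F G) t ∘ₗ ((G t).comap (F t).subtype).mkQ

theorem symbol_eq_symbol {t : ι} {a b : F t} (h : (a : M) - b ∈ G t) :
    symbol F G t a = symbol F G t b :=
  congrArg (DirectSum.lof R ι (Piece F G) t)
    ((Submodule.Quotient.eq ((G t).comap (F t).subtype)).2 h)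

theorem symbol_congr {s t : ι} (hst : s = t) {a : F s} {b : F t} (h : (a : M) = b) :
    symbol F G s a = symbol F G t b := by
  subst hst
  rw [Subtype.ext h]

@[elab_as_elim]
theorem symbol_induction {P : AssociatedGraded F G → Prop} (x : AssociatedGraded F G) (zero : P 0)
    (symbol : ∀ t (a : F t), P (symbol F G t a)) (add : ∀ x y, P x → P y → P (x + y)) : P x := by
  induction x using DirectSum.induction_on with
  | zero => exact zero
  | of t p =>
    obtain ⟨a, rfl⟩ := Submodule.mkQ_surjective _ p
    exact symbol t a
  | add x y hx hy => exact add x y hx hy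

theorem mul_symbol_symbol [Add ι] (hμ : IsFilteredProduct F G μ) {s t : ι} (a : F s) (b : F t) :
    mul hμ (symbol F G s a) (symbol F G t b) =
      symbol F G (s + t) ⟨μ a b, hμ.mul_mem s t a b a.2 b.2⟩ := by
  rw [mul, symbol, symbol, LinearMap.comp_apply, LinearMap.comp_apply, DirectSum.toModule_lof,
    LinearMap.flip_apply, DirectSum.toModule_lof]
  rfl

protected theorem mul_assoc [AddSemigroup ι] (hμ : IsFilteredProduct F G μ)
    (assoc : ∀ a b c, μ (μ a b) c = μ a (μ b c)) (x y z : AssociatedGraded F G) :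
    mul hμ (mul hμ x y) z = mul hμ x (mul hμ y z) := by
  induction x using symbol_induction with
  | zero => simp
  | add x x' hx hx' => simp only [map_add, LinearMap.add_apply, hx, hx']
  | symbol r a =>
    induction y using symbol_induction with
    | zero => simp
    | add y y' hy hy' => simp only [map_add, LinearMap.add_apply, hy, hy']
    | symbol s b =>
      induction z using symbol_induction with
      | zero => simp
      | add z z' hz hz' => simp only [map_add, hz, hz']
      | symbol t c =>
        simp only [mul_symbol_symbol]
        exact symbol_congr (add_assoc r s t) (assoc a b c)

protected theorem mul_comm [AddCommMagma ι] (hμ : IsFilteredProduct F G μ)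
    (comm : ∀ (s t : ι) (a b : M), a ∈ F s → b ∈ F t → μ a b - μ b a ∈ G (s + t))
    (x y : AssociatedGraded F G) : mul hμ x y = mul hμ y x := by
  induction x using symbol_induction with
  | zero => simp
  | add x x' hx hx' => simp only [map_add, LinearMap.add_apply, hx, hx']
  | symbol s a =>
    induction y using symbol_induction with
    | zero => simp
    | add y y' hy hy' => simp only [map_add, LinearMap.add_apply, hy, hy']
    | symbol t b =>
      rw [mul_symbol_symbol, mul_symbol_symbol, symbol_congr (add_comm t s)
        (b := ⟨μ b a, add_comm t s ▸ hμ.mul_mem t s b a b.2 a.2⟩) rfl]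
      exact symbol_eq_symbol (comm s t a b a.2 b.2)

protected theorem one_mul [AddZeroClass ι] (hμ : IsFilteredProduct F G μ) {e : M} (he : e ∈ F 0)
    (left_one : ∀ a, μ e a = a) (x : AssociatedGraded F G) :
    mul hμ (symbol F G 0 ⟨e, he⟩) x = x := by
  induction x using symbol_induction with
  | zero => simp
  | add x x' hx hx' => rw [map_add, hx, hx']
  | symbol t a =>
    rw [mul_symbol_symbol]
    exact symbol_congr (zero_add t) (left_one a)

end AssociatedGraded

end AssociatedGraded

namespace VertexAlgebra

open HahnSeries LaurentSeries Finset Function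

variable {V : Type*} [AddCommGroup V] [Module ℂ V] (A : VertexAlgebra V)

theorem finite_support_coeff_smul_mode (f : LaurentSeries ℂ) (u v : V) :
    (support fun n : ℤ => f.coeff n • A.mode u n v).Finite := by
  obtain ⟨N, hN⟩ := A.exists_mode_eq_zero u v
  refine (Set.finite_Ico f.order N).subset fun n hn => ⟨?_, ?_⟩
  · exact order_le_of_coeff_ne_zero (left_ne_zero_of_smul hn)
  · exact not_le.1 fun h => right_ne_zero_of_smul hn (hN n h)

/-- The residue `Res_z f(z) Y(u, z) v` for an arbitrary Laurent series `f`, as a trilinear map; the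
residues `VertexAlgebra.res` are those for `f = (1 + z)^a z^{-b}`. -/
noncomputable def smear : LaurentSeries ℂ →ₗ[ℂ] V →ₗ[ℂ] V →ₗ[ℂ] V where
  toFun f := LinearMap.mk₂ ℂ (fun u v => ∑ᶠ n : ℤ, f.coeff n • A.mode u n v)
    (fun u u' v => by
      rw [← finsum_add_distrib (A.finite_support_coeff_smul_mode f u v)
        (A.finite_support_coeff_smul_mode f u' v)]
      simp only [mode_add, smul_add])
    (fun c u v => by
      rw [smul_finsum' c (A.finite_support_coeff_smul_mode f u v)]
      simp only [mode_smul, smul_comm c])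
    (fun u v v' => by
      rw [← finsum_add_distrib (A.finite_support_coeff_smul_mode f u v)
        (A.finite_support_coeff_smul_mode f u v')]
      simp only [map_add, smul_add])
    (fun c u v => by
      rw [smul_finsum' c (A.finite_support_coeff_smul_mode f u v)]
      simp only [map_smul, smul_comm c])
  map_add' f g := by
    ext u v
    simp only [LinearMap.mk₂_apply, LinearMap.add_apply]
    rw [← finsum_add_distrib (A.finite_support_coeff_smul_mode f u v)
      (A.finite_support_coeff_smul_mode g u v)]
    simp only [coeff_add, add_smul]
  map_smul' c f := by
    ext u v
    simp only [LinearMap.mk₂_apply, LinearMap.smul_apply, RingHom.id_apply]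
    rw [smul_finsum' c (A.finite_support_coeff_smul_mode f u v)]
    simp only [coeff_smul, smul_eq_mul, mul_smul]

theorem smear_apply (f : LaurentSeries ℂ) (u v : V) :
    A.smear f u v = ∑ᶠ n : ℤ, f.coeff n • A.mode u n v := rfl

theorem smear_mem (W : Submodule ℂ V) {f : LaurentSeries ℂ} {u v : V}
    (h : ∀ n, f.coeff n ≠ 0 → A.mode u n v ∈ W) : A.smear f u v ∈ W := by
  rw [smear_apply]
  refine finsum_induction (· ∈ W) W.zero_mem (fun _ _ => W.add_mem) fun n => ?_
  by_cases hn : f.coeff n = 0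
  · simp [hn]
  · exact W.smul_mem _ (h n hn)

theorem smear_single (n : ℤ) (c : ℂ) (u v : V) :
    A.smear (single n c) u v = c • A.mode u n v := by
  rw [smear_apply, finsum_eq_single _ n fun m hm => by rw [coeff_single_of_ne hm, zero_smul],
    coeff_single_same]

theorem vanishesAtHighOrder_smear (u v : V) : VanishesAtHighOrder fun f => A.smear f u v := by
  obtain ⟨N, hN⟩ := A.exists_mode_eq_zero u v
  refine ⟨N, fun f hf => (Submodule.mem_bot ℂ).1 (A.smear_mem ⊥ fun n hn => ?_)⟩
  exact hN n (not_lt.1 fun h => hn (hf n h))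

theorem smear_onePlusPow (p q : ℤ) (u v : V) :
    A.smear (onePlusPow ℂ p q) u v = ∑ᶠ i : ℕ, Ring.choose p i • A.mode u (q + i) v := by
  have shift_injective : Injective fun i : ℕ => q + (i : ℤ) := fun i j h => by simpa using h
  rw [smear_apply, ← finsum_mem_univ, finsum_mem_inter_support_eq' _ _
    (Set.range fun i : ℕ => q + (i : ℤ)) fun n hn => ?_, finsum_mem_range shift_injective]
  · simp only [coeff_onePlusPow_add_natCast, Int.cast_smul_eq_zsmul]
  · have hqn : q ≤ n := not_lt.1 (mt coeff_onePlusPow_of_lt (left_ne_zero_of_smul hn))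
    exact iff_of_true trivial ⟨(n - q).toNat, by lia⟩

theorem res_eq_smear (a b : ℤ) (u v : V) : A.res a b u v = A.smear (onePlusPow ℂ a (-b)) u v := by
  simp only [smear_onePlusPow, neg_add_eq_sub]
  rfl

theorem mode_eq_ncoeff (u : V) : A.mode u = VertexOperator.ncoeff (A.Y u) := rfl

theorem mode_zero_left (n : ℤ) (w : V) : A.mode 0 n w = 0 := by
  simp [mode]

theorem mode_vac_left (n : ℤ) (w : V) : A.mode A.vac n w = if n = -1 then w else 0 :=
  A.vacuum n w

theorem mode_vac_right (u : V) (i : ℕ) : A.mode u i A.vac = 0 :=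
  A.creation_nonneg u i (Int.natCast_nonneg i)

theorem mode_neg_one_vac (u : V) : A.mode u (-1) A.vac = u :=
  A.creation_neg_one u

theorem smear_vac_left (f : LaurentSeries ℂ) (w : V) : A.smear f A.vac w = f.coeff (-1) • w := by
  rw [smear_apply, finsum_eq_single _ (-1) fun n hn => by
    rw [mode_vac_left, if_neg hn, smul_zero], mode_vac_left, if_pos rfl]

theorem smear_onePlusPow_vac_right (p : ℤ) (u : V) :
    A.smear (onePlusPow ℂ p (-1)) u A.vac = u := by
  rw [smear_onePlusPow, finsum_eq_single _ 0 fun i hi => ?_]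
  · simpa using A.mode_neg_one_vac u
  · obtain ⟨j, rfl⟩ := Nat.exists_eq_add_one_of_ne_zero hi
    simp [mode_vac_right]

theorem mode_commutator {u v : V} {N : ℕ} (hN : ∀ i : ℕ, N ≤ i → A.mode u i v = 0) (m n : ℤ)
    (w : V) :
    A.mode u m (A.mode v n w) - A.mode v n (A.mode u m w) =
      ∑ i ∈ range N, Ring.choose m i • A.mode (A.mode u i v) (m + n - i) w := by
  have h := A.jacobi u v w 0 m n
  simp only [← mode_eq_ncoeff, zero_add] at h
  rw [finsum_eq_single _ 0 fun i hi => by simp [Ring.choose_zero_pos _ (Nat.pos_of_ne_zero hi)],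
    finsum_eq_single _ 0 fun i hi => by simp [Ring.choose_zero_pos _ (Nat.pos_of_ne_zero hi)],
    finsum_eq_sum_of_support_subset (s := range N) _ fun i hi => ?_] at h
  · simpa using h
  · rw [mem_coe, mem_range]
    by_contra! hi'
    exact hi (by simp only [hN i hi', mode_zero_left, smul_zero])

theorem smear_commutator {u v : V} {N : ℕ} (hN : ∀ i : ℕ, N ≤ i → A.mode u i v = 0)
    (f g : LaurentSeries ℂ) (w : V) :
    A.smear f u (A.smear g v w) - A.smear g v (A.smear f u w) =
      ∑ i ∈ range N, A.smear (hasseDeriv ℂ i f * g) (A.mode u i v) w := by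
  -- Both sides are continuous in each of `f` and `g`, so it suffices to compare them on monomials.
  rw [← sub_eq_zero]
  revert g
  refine VanishesAtHighOrder.eq_zero ?_ ?_ fun n d => ?_
  · exact (((A.vanishesAtHighOrder_smear v w).map (A.smear f u)).sub
      (A.vanishesAtHighOrder_smear v _)).sub
        (.sum _ fun i _ => (A.vanishesAtHighOrder_smear _ w).comp_mul_left _)
  · intro g g'
    simp only [map_add, LinearMap.add_apply, mul_add, sum_add_distrib]
    abel
  revert f
  refine VanishesAtHighOrder.eq_zero ?_ ?_ fun m c => ?_
  · refine ((A.vanishesAtHighOrder_smear u _).sub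
      ((A.vanishesAtHighOrder_smear u w).map (A.smear _ v))).sub (.sum _ fun i _ => ?_)
    simp only [mul_comm _ (single n d)]
    exact ((A.vanishesAtHighOrder_smear _ w).comp_mul_left _).comp_hasseDeriv i
  · intro f f'
    simp only [map_add, LinearMap.add_apply, add_mul, sum_add_distrib]
    abel
  · simp only [hasseDeriv_single, single_mul_single, smear_single, map_smul, smul_comm d c,
      ← smul_sub, A.mode_commutator hN, smul_sum, sub_eq_zero]
    refine sum_congr rfl fun i _ => ?_
    rw [sub_add_eq_add_sub, ← Int.cast_smul_eq_zsmul ℂ, smul_smul, smul_smul, zsmul_eq_mul]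
    ring_nf

/-- The translation operator `v ↦ v₋₂𝟏`. -/
noncomputable def deriv (u : V) : V := A.mode u (-2) A.vac

theorem mode_deriv (u w : V) (n : ℤ) : A.mode (A.deriv u) n w = -n • A.mode u (n - 1) w := by
  have h := A.jacobi u A.vac w (-2) n 0
  simp only [← mode_eq_ncoeff, zero_add, add_zero] at h
  rw [finsum_eq_zero_of_forall_eq_zero fun i => by
      rw [mode_vac_left, if_neg (by lia), map_zero, smul_zero],
    finsum_eq_zero_of_forall_eq_zero fun i => by
      rw [mode_vac_left, if_neg (by lia), smul_zero],
    finsum_eq_sum_of_support_subset (s := range 2) _ fun i hi => ?_] at h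
  · have h' : 0 = A.mode (A.deriv u) n w + n • A.mode u (n - 1) w := by
      simpa [sum_range_succ, mode_neg_one_vac, deriv] using h
    rw [neg_smul]
    exact eq_neg_of_add_eq_zero_left h'.symm
  · rw [mem_coe, mem_range]
    by_contra! hi'
    obtain ⟨j, rfl⟩ := Nat.exists_eq_add_of_le hi'
    exact hi (by simp [mode_vac_right, mode_zero_left])

theorem smear_deriv (f : LaurentSeries ℂ) (u w : V) :
    A.smear f (A.deriv u) w = -A.smear (hasseDeriv ℂ 1 f) u w := by
  rw [smear_apply, smear_apply, ← finsum_neg_distrib,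
    ← finsum_comp_equiv (Equiv.addRight (1 : ℤ))]
  refine finsum_congr fun n => ?_
  rw [mode_deriv, hasseDeriv_coeff, ← Int.cast_smul_eq_zsmul ℂ]
  simp only [Equiv.coe_addRight, add_sub_cancel_right, Nat.cast_one, Ring.choose_one_right,
    smul_smul, zsmul_eq_mul, ← neg_smul]
  congr 1
  push_cast
  ring

theorem smear_onePlusPow_sub_one (p q : ℤ) (u v : V) :
    (q : ℂ) • A.smear (onePlusPow ℂ p (q - 1)) u v =
      -A.smear (onePlusPow ℂ (p + 1) q) (A.deriv u) v -
        ((p + 1 + q : ℤ) : ℂ) • A.smear (onePlusPow ℂ p q) u v := by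
  rw [smear_deriv, hasseDeriv_one_onePlusPow, onePlusPow_add_one_left p (q - 1), sub_add_cancel,
    add_sub_cancel_right]
  simp only [← Int.cast_smul_eq_zsmul ℂ, map_add, map_smul, LinearMap.add_apply,
    LinearMap.smul_apply]
  push_cast
  module

end VertexAlgebra

namespace CGradedVertexAlgebra

open HahnSeries LaurentSeries Finset VertexAlgebra

variable {V : Type*} [AddCommGroup V] [Module ℂ V] (A : CGradedVertexAlgebra V)

@[elab_as_elim]
theorem homogeneous_induction {P : V → Prop} (v : V) (hom : ∀ lam, ∀ v ∈ A.wt lam, P v)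
    (zero : P 0) (add : ∀ v w, P v → P w → P (v + w)) : P v :=
  Submodule.iSup_induction A.wt (motive := P) (by simp [A.isInternal.submodule_iSup_eq_top]) hom
    zero add

theorem mode_mem_of_intCast {k : ℤ} {lam : ℂ} {u v : V} (hu : u ∈ A.wt k) (hv : v ∈ A.wt lam)
    (n : ℤ) : A.mode u n v ∈ A.wt (lam + (k - n - 1 : ℤ)) := by
  convert A.mode_mem _ _ n _ _ hu hv using 2
  push_cast
  ring

theorem deriv_mem {lam : ℂ} {u : V} (hu : u ∈ A.wt lam) : A.deriv u ∈ A.wt (lam + (1 : ℤ)) := by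
  rw [VertexAlgebra.deriv]
  convert A.mode_mem _ _ (-2) _ _ hu A.vac_mem using 2
  push_cast
  ring

theorem extend_of_mem (f : ℂ → V →ₗ[ℂ] V →ₗ[ℂ] V) {lam : ℂ} {u : V} (hu : u ∈ A.wt lam) :
    A.extend f u = f lam u := by
  have decomposition : (LinearEquiv.ofBijective (DirectSum.coeLinearMap A.wt) A.isInternal).symm u =
      DirectSum.lof ℂ ℂ (fun lam => A.wt lam) lam ⟨u, hu⟩ := by
    rw [LinearEquiv.symm_apply_eq]
    exact (DirectSum.coeLinearMap_lof A.wt lam ⟨u, hu⟩).symm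
  rw [extend, LinearMap.comp_apply, LinearEquiv.coe_coe, decomposition, DirectSum.toModule_lof]
  rfl

theorem delta_intCast (n : ℤ) : delta n = 1 := by
  simp [delta]

theorem delta_of_forall_ne {lam : ℂ} (h : ∀ n : ℤ, lam ≠ n) : delta lam = 0 :=
  if_neg fun h' => h _ (sub_eq_zero.1 h')

theorem delta_add_intCast (lam : ℂ) (n : ℤ) : delta (lam + n) = delta lam := by
  simp [delta]

theorem delta_nonneg (lam : ℂ) : 0 ≤ delta lam := by
  rw [delta]
  split_ifs <;> simp

theorem ceil_re_add_intCast (lam : ℂ) (n : ℤ) : ⌈(lam + n).re⌉ = ⌈lam.re⌉ + n := by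
  simp

theorem circ_of_mem {lam : ℂ} {u : V} (hu : u ∈ A.wt lam) (v : V) :
    A.circ u v = A.smear (onePlusPow ℂ (⌈lam.re⌉ + delta lam - 1) (-(1 + delta lam))) u v := by
  rw [circ, A.extend_of_mem _ hu, res_eq_smear]

theorem star_of_mem_intCast {n : ℤ} {u : V} (hu : u ∈ A.wt n) (v : V) :
    A.star u v = A.smear (onePlusPow ℂ n (-1)) u v := by
  rw [star, A.extend_of_mem _ hu, delta_intCast, one_smul, res_eq_smear, Complex.intCast_re,
    Int.ceil_intCast]

theorem star_of_forall_ne {lam : ℂ} (h : ∀ n : ℤ, lam ≠ n) {u : V} (hu : u ∈ A.wt lam) :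
    A.star u = 0 := by
  rw [star, A.extend_of_mem _ hu, delta_of_forall_ne h, zero_smul, LinearMap.zero_apply]

/-- The operators `δ Res_z (1+z)^{|v|-1} z^{-1} Y(v,z)`, linear in `v`. Modulo `O(V)`, `rightStar v`
is right multiplication by `v` for the product `*`. -/
noncomputable def rightStar : V →ₗ[ℂ] V →ₗ[ℂ] V :=
  A.extend fun lam => delta lam • A.res (⌈lam.re⌉ - 1) 1

theorem rightStar_of_mem_intCast {n : ℤ} {v : V} (hv : v ∈ A.wt n) (u : V) :
    A.rightStar v u = A.smear (onePlusPow ℂ (n - 1) (-1)) v u := by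
  rw [rightStar, A.extend_of_mem _ hv, delta_intCast, one_smul, res_eq_smear, Complex.intCast_re,
    Int.ceil_intCast]

theorem rightStar_of_forall_ne {lam : ℂ} (h : ∀ n : ℤ, lam ≠ n) {v : V} (hv : v ∈ A.wt lam) :
    A.rightStar v = 0 := by
  rw [rightStar, A.extend_of_mem _ hv, delta_of_forall_ne h, zero_smul, LinearMap.zero_apply]

theorem star_sub_rightStar_of_mem_intCast {n : ℤ} {u : V} (hu : u ∈ A.wt n) (v : V) :
    A.star u v - A.rightStar u v = A.smear (onePlusPow ℂ (n - 1) 0) u v := by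
  rw [A.star_of_mem_intCast hu, A.rightStar_of_mem_intCast hu, sub_eq_iff_eq_add',
    ← LinearMap.add_apply, ← LinearMap.add_apply, ← map_add]
  simpa using congrArg (A.smear · u v) (onePlusPow_add_one_left (R := ℂ) (n - 1) (-1))

theorem circ_mem_zhuO (u v : V) : A.circ u v ∈ A.zhuO :=
  Submodule.subset_span ⟨u, v, rfl⟩

theorem zhuO_le {W : Submodule ℂ V} (h : ∀ lam, ∀ u ∈ A.wt lam, ∀ v, A.circ u v ∈ W) :
    A.zhuO ≤ W := by
  rw [zhuO, Submodule.span_le]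
  rintro _ ⟨u, v, rfl⟩
  induction u using A.homogeneous_induction with
  | hom lam u hu => exact h lam u hu v
  | zero => simp
  | add u u' hu hu' => simpa using add_mem hu hu'

theorem smear_onePlusPow_sub_natCast_mem_zhuO (n : ℕ) {lam : ℂ} {u : V} (hu : u ∈ A.wt lam)
    (v : V) :
    A.smear (onePlusPow ℂ (⌈lam.re⌉ + delta lam - 1) (-(1 + delta lam) - n)) u v ∈ A.zhuO := by
  induction n generalizing lam u with
  | zero =>
    rw [Nat.cast_zero, sub_zero, ← A.circ_of_mem hu]
    exact A.circ_mem_zhuO u v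
  | succ n ih =>
    have deriv_mem_zhuO := ih (A.deriv_mem hu)
    rw [ceil_re_add_intCast, delta_add_intCast, add_right_comm,
      add_sub_right_comm] at deriv_mem_zhuO
    have exponent_ne_zero : ((-(1 + delta lam) - n : ℤ) : ℂ) ≠ 0 := by
      have := delta_nonneg lam
      exact_mod_cast (by lia : -(1 + delta lam) - n ≠ 0)
    rw [Nat.cast_succ, ← sub_sub, ← A.zhuO.smul_mem_iff exponent_ne_zero,
      smear_onePlusPow_sub_one]
    exact sub_mem (neg_mem deriv_mem_zhuO) (Submodule.smul_mem _ _ (ih hu))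

theorem smear_onePlusPow_mem_zhuO {m n : ℕ} (hmn : m ≤ n) {lam : ℂ} {u : V} (hu : u ∈ A.wt lam)
    (v : V) :
    A.smear (onePlusPow ℂ (⌈lam.re⌉ + delta lam - 1 + m) (-(1 + delta lam) - n)) u v ∈
      A.zhuO := by
  induction m generalizing n with
  | zero => simpa using A.smear_onePlusPow_sub_natCast_mem_zhuO n hu v
  | succ m ih =>
    obtain ⟨n, rfl⟩ : ∃ k, n = k + 1 := ⟨n - 1, by lia⟩
    rw [Nat.cast_succ m, ← add_assoc, onePlusPow_add_one_left, map_add, LinearMap.add_apply,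
      LinearMap.add_apply]
    refine add_mem (ih (by lia)) ?_
    rw [Nat.cast_succ, ← sub_sub, sub_add_cancel]
    exact ih (by lia)

theorem wt_le_zhuO {lam : ℂ} (h : ∀ n : ℤ, lam ≠ n) : A.wt lam ≤ A.zhuO := by
  intro u hu
  have circ_vac := A.circ_mem_zhuO u A.vac
  rwa [A.circ_of_mem hu, delta_of_forall_ne h, add_zero, add_zero,
    smear_onePlusPow_vac_right] at circ_vac

theorem smear_commutator_mem_zhuO {m n : ℕ} (hmn : m ≤ n) {k p q p' q' : ℤ} {lam : ℂ}
    (hp : p + p' = k + ⌈lam.re⌉ + delta lam - 2 + m) (hq : q + q' = -(1 + delta lam) - n)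
    {c a : V} (hc : c ∈ A.wt k) (ha : a ∈ A.wt lam) (b : V) :
    A.smear (onePlusPow ℂ p q) c (A.smear (onePlusPow ℂ p' q') a b) -
      A.smear (onePlusPow ℂ p' q') a (A.smear (onePlusPow ℂ p q) c b) ∈ A.zhuO := by
  -- `c_i a` has weight `|a| + k - i - 1`, and the `i`-th Hasse derivative lowers the exponents of
  -- `1 + z` and `z` by `i` in total: a drop of `j` in the latter leaves a surplus of `j` in the
  -- former, so every term has the shape in `smear_onePlusPow_mem_zhuO`.
  obtain ⟨N, hN⟩ := A.exists_mode_eq_zero c a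
  rw [A.smear_commutator (N := N.toNat) fun i hi => hN i (Int.toNat_le.1 hi)]
  refine sum_mem fun i _ => ?_
  rw [hasseDeriv_onePlusPow, sum_mul, map_sum, LinearMap.sum_apply, LinearMap.sum_apply]
  refine sum_mem fun ⟨i', j⟩ hij => ?_
  rw [HasAntidiagonal.mem_antidiagonal] at hij
  rw [smul_mul_assoc, onePlusPow_mul_onePlusPow, map_zsmul, LinearMap.smul_apply,
    LinearMap.smul_apply]
  refine zsmul_mem ?_ _
  have h := A.smear_onePlusPow_mem_zhuO (Nat.add_le_add_right hmn j)
    (A.mode_mem_of_intCast hc ha i) b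
  rw [ceil_re_add_intCast, delta_add_intCast] at h
  convert h using 5 <;> push_cast <;> lia

theorem smear_mem_zhuO_of_mem_zhuO {m n : ℕ} (hmn : m ≤ n) {k : ℤ} {c x : V} (hc : c ∈ A.wt k)
    (hx : x ∈ A.zhuO) : A.smear (onePlusPow ℂ (k - 1 + m) (-n)) c x ∈ A.zhuO := by
  suffices h : A.zhuO ≤ A.zhuO.comap (A.smear (onePlusPow ℂ (k - 1 + m) (-n)) c) from h hx
  refine A.zhuO_le fun lam a ha b => ?_
  rw [Submodule.mem_comap, A.circ_of_mem ha, ← sub_add_cancel (A.smear _ c _)]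
  refine add_mem (A.smear_commutator_mem_zhuO hmn (by ring) (by ring) hc ha b) ?_
  rw [← A.circ_of_mem ha]
  exact A.circ_mem_zhuO a _

@[elab_as_elim]
theorem intCast_weight_induction {P : V → Prop} (v : V) (hom : ∀ n : ℤ, ∀ v ∈ A.wt n, P v)
    (nonintegral : ∀ lam : ℂ, (∀ n : ℤ, lam ≠ n) → ∀ v ∈ A.wt lam, P v)
    (zero : P 0) (add : ∀ v w, P v → P w → P (v + w)) : P v := by
  refine A.homogeneous_induction v (fun lam v hv => ?_) zero add
  by_cases h : ∀ n : ℤ, lam ≠ n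
  · exact nonintegral lam h v hv
  · push Not at h
    obtain ⟨n, rfl⟩ := h
    exact hom n v hv

theorem star_mem_zhuO_of_mem_right (u : V) {x : V} (hx : x ∈ A.zhuO) : A.star u x ∈ A.zhuO := by
  induction u using A.intCast_weight_induction with
  | hom n u hu =>
    rw [A.star_of_mem_intCast hu]
    simpa using A.smear_mem_zhuO_of_mem_zhuO (le_refl 1) hu hx
  | nonintegral lam h u hu => simp [A.star_of_forall_ne h hu]
  | zero => simp
  | add u u' h h' => simpa using add_mem h h'

theorem rightStar_mem_zhuO_of_mem (v : V) {x : V} (hx : x ∈ A.zhuO) :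
    A.rightStar v x ∈ A.zhuO := by
  induction v using A.intCast_weight_induction with
  | hom n v hv =>
    rw [A.rightStar_of_mem_intCast hv]
    simpa using A.smear_mem_zhuO_of_mem_zhuO zero_le_one hv hx
  | nonintegral lam h v hv => simp [A.rightStar_of_forall_ne h hv]
  | zero => simp
  | add v v' h h' => simpa using add_mem h h'

theorem cls_eq_cls {u v : V} : A.cls u = A.cls v ↔ u - v ∈ A.zhuO :=
  Submodule.Quotient.eq _

theorem cls_star_rightStar (u v w : V) :
    A.cls (A.star u (A.rightStar v w)) = A.cls (A.rightStar v (A.star u w)) := by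
  induction u using A.intCast_weight_induction with
  | nonintegral lam h u hu => simp [A.star_of_forall_ne h hu]
  | zero => simp
  | add u u' h h' => simp only [map_add, LinearMap.add_apply, h, h']
  | hom m u hu =>
    induction v using A.intCast_weight_induction with
    | nonintegral lam h v hv => simp [A.rightStar_of_forall_ne h hv]
    | zero => simp
    | add v v' h h' => simp only [map_add, LinearMap.add_apply, h, h']
    | hom n v hv =>
      rw [cls_eq_cls, A.star_of_mem_intCast hu, A.star_of_mem_intCast hu,
        A.rightStar_of_mem_intCast hv, A.rightStar_of_mem_intCast hv]
      exact A.smear_commutator_mem_zhuO (le_refl 0)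
        (by rw [delta_intCast, Complex.intCast_re, Int.ceil_intCast]; push_cast; ring)
        (by rw [delta_intCast]; rfl) hu hv w

theorem cls_star_vac (u : V) : A.cls (A.star u A.vac) = A.cls u := by
  induction u using A.intCast_weight_induction with
  | hom n u hu => rw [A.star_of_mem_intCast hu, smear_onePlusPow_vac_right]
  | nonintegral lam h u hu =>
    rw [cls_eq_cls, A.star_of_forall_ne h hu, LinearMap.zero_apply, zero_sub, neg_mem_iff]
    exact A.wt_le_zhuO h hu
  | zero => simp
  | add u u' h h' => simp only [map_add, LinearMap.add_apply, h, h']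

theorem cls_rightStar_vac (v : V) : A.cls (A.rightStar v A.vac) = A.cls v := by
  induction v using A.intCast_weight_induction with
  | hom n v hv => rw [A.rightStar_of_mem_intCast hv, smear_onePlusPow_vac_right]
  | nonintegral lam h v hv =>
    rw [cls_eq_cls, A.rightStar_of_forall_ne h hv, LinearMap.zero_apply, zero_sub, neg_mem_iff]
    exact A.wt_le_zhuO h hv
  | zero => simp
  | add v v' h h' => simp only [map_add, LinearMap.add_apply, h, h']

theorem cls_star_congr_right (u : V) {v v' : V} (h : A.cls v = A.cls v') :
    A.cls (A.star u v) = A.cls (A.star u v') := by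
  rw [cls_eq_cls, ← map_sub]
  exact A.star_mem_zhuO_of_mem_right u (A.cls_eq_cls.1 h)

theorem cls_rightStar_congr_right (v : V) {u u' : V} (h : A.cls u = A.cls u') :
    A.cls (A.rightStar v u) = A.cls (A.rightStar v u') := by
  rw [cls_eq_cls, ← map_sub]
  exact A.rightStar_mem_zhuO_of_mem v (A.cls_eq_cls.1 h)

theorem cls_star_eq_cls_rightStar (u v : V) : A.cls (A.star u v) = A.cls (A.rightStar v u) :=
  calc
    A.cls (A.star u v) = A.cls (A.star u (A.rightStar v A.vac)) :=
      A.cls_star_congr_right u (A.cls_rightStar_vac v).symm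
    _ = A.cls (A.rightStar v (A.star u A.vac)) := A.cls_star_rightStar u v A.vac
    _ = A.cls (A.rightStar v u) := A.cls_rightStar_congr_right v (A.cls_star_vac u)

theorem star_mem_zhuO_of_mem_left {x : V} (hx : x ∈ A.zhuO) (v : V) : A.star x v ∈ A.zhuO := by
  rw [← A.zhuO.ker_mkQ, LinearMap.mem_ker]
  refine (A.cls_star_eq_cls_rightStar x v).trans ?_
  rw [← LinearMap.mem_ker, Submodule.ker_mkQ]
  exact A.rightStar_mem_zhuO_of_mem v hx

theorem cls_star_assoc (u v w : V) :
    A.cls (A.star (A.star u v) w) = A.cls (A.star u (A.star v w)) :=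
  calc
    A.cls (A.star (A.star u v) w) = A.cls (A.rightStar w (A.star u v)) :=
      A.cls_star_eq_cls_rightStar _ w
    _ = A.cls (A.star u (A.rightStar w v)) := (A.cls_star_rightStar u w v).symm
    _ = A.cls (A.star u (A.star v w)) :=
      A.cls_star_congr_right u (A.cls_star_eq_cls_rightStar v w).symm

/-- The product induced by `*` on `A(V)`. -/
noncomputable def zhuMul : A.Zhu →ₗ[ℂ] A.Zhu →ₗ[ℂ] A.Zhu :=
  (A.zhuO.liftQ
    (A.zhuO.liftQ (A.star.compr₂ A.zhuO.mkQ) fun _ hx => LinearMap.ext fun v =>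
      (Submodule.Quotient.mk_eq_zero _).2 (A.star_mem_zhuO_of_mem_left hx v)).flip
    fun _ hx => LinearMap.ext <| A.zhuO.mkQ_surjective.forall.2 fun u =>
      (Submodule.Quotient.mk_eq_zero _).2 (A.star_mem_zhuO_of_mem_right u hx)).flip

theorem zhuMul_cls (u v : V) : A.zhuMul (A.cls u) (A.cls v) = A.cls (A.star u v) :=
  rfl

theorem zhuMul_assoc (a b c : A.Zhu) :
    A.zhuMul (A.zhuMul a b) c = A.zhuMul a (A.zhuMul b c) := by
  obtain ⟨u, rfl⟩ := A.zhuO.mkQ_surjective a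
  obtain ⟨v, rfl⟩ := A.zhuO.mkQ_surjective b
  obtain ⟨w, rfl⟩ := A.zhuO.mkQ_surjective c
  exact A.cls_star_assoc u v w

theorem vac_mem_intCast : A.vac ∈ A.wt (0 : ℤ) := by
  simpa using A.vac_mem

theorem vac_zhuMul (a : A.Zhu) : A.zhuMul (A.cls A.vac) a = a := by
  obtain ⟨v, rfl⟩ := A.zhuO.mkQ_surjective a
  rw [zhuMul_cls, A.star_of_mem_intCast A.vac_mem_intCast, smear_vac_left, onePlusPow_zero_left,
    coeff_single_same, one_smul]

theorem zhuMul_vac (a : A.Zhu) : A.zhuMul a (A.cls A.vac) = a := by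
  obtain ⟨u, rfl⟩ := A.zhuO.mkQ_surjective a
  exact A.cls_star_vac u

theorem fil_le {t : ℕ} {W : Submodule ℂ A.Zhu}
    (h : ∀ j ≤ t, ∀ v ∈ A.wt (j : ℤ), A.cls v ∈ W) : A.fil t ≤ W := by
  rw [fil, Submodule.map_le_iff_le_comap]
  exact iSup₂_le fun j hj v hv => h j hj v (by simpa using hv)

theorem cls_mem_fil_of_le {j t : ℕ} (h : j ≤ t) {v : V} (hv : v ∈ A.wt (j : ℤ)) :
    A.cls v ∈ A.fil t :=
  Submodule.mem_map_of_mem <| Submodule.mem_iSup_of_mem j <| Submodule.mem_iSup_of_mem h <| by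
    simpa using hv

theorem fil_mono : Monotone A.fil := fun _ _ hst =>
  A.fil_le fun _ hj _ hv => A.cls_mem_fil_of_le (hj.trans hst) hv

variable {A}

theorem wt_eq_bot_of_neg (hV0 : A.part 0 = ⨆ n : ℕ, A.wt (n : ℂ)) {k : ℤ} (hk : k < 0) :
    A.wt k = ⊥ := by
  rw [← le_bot_iff, ← (A.isInternal.submodule_iSupIndep (k : ℂ)).eq_bot]
  refine le_inf le_rfl ?_
  have wt_le_part : A.wt k ≤ A.part 0 := fun v hv => Submodule.subset_span ⟨k, hv, by simp⟩
  refine wt_le_part.trans (hV0.le.trans (iSup_le fun n => le_iSup₂_of_le (n : ℂ) ?_ le_rfl))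
  exact_mod_cast (by lia : (n : ℤ) ≠ k)

theorem cls_mem_fil (hV0 : A.part 0 = ⨆ n : ℕ, A.wt (n : ℂ)) {k : ℤ} {t : ℕ} (h : k ≤ t) {v : V}
    (hv : v ∈ A.wt k) : A.cls v ∈ A.fil t := by
  rcases lt_or_ge k 0 with hk | hk
  · rw [wt_eq_bot_of_neg hV0 hk, Submodule.mem_bot] at hv
    simp [hv]
  · lift k to ℕ using hk
    exact A.cls_mem_fil_of_le (by exact_mod_cast h) hv

theorem cls_mem_filPred (hV0 : A.part 0 = ⨆ n : ℕ, A.wt (n : ℂ)) {k : ℤ} {t : ℕ} (h : k < t)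
    {v : V} (hv : v ∈ A.wt k) : A.cls v ∈ A.filPred t := by
  cases t with
  | zero =>
    rw [wt_eq_bot_of_neg hV0 (by simpa using h), Submodule.mem_bot] at hv
    simp [hv]
  | succ t => exact cls_mem_fil hV0 (by lia) hv

theorem iSup_fil (hV0 : A.part 0 = ⨆ n : ℕ, A.wt (n : ℂ)) : ⨆ t : ℕ, A.fil t = ⊤ := by
  rw [eq_top_iff, ← A.zhuO.range_mkQ]
  rintro _ ⟨v, rfl⟩
  induction v using A.intCast_weight_induction with
  | hom n v hv => exact Submodule.mem_iSup_of_mem n.toNat (cls_mem_fil hV0 (by lia) hv)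
  | nonintegral lam h v hv =>
    rw [LinearMap.mem_ker.1 (A.zhuO.ker_mkQ.symm ▸ A.wt_le_zhuO h hv)]
    exact zero_mem _
  | zero => simp
  | add v w hv hw => simpa using add_mem hv hw

theorem cls_smear_onePlusPow_mem_filPred (hV0 : A.part 0 = ⨆ n : ℕ, A.wt (n : ℂ))
    {p q : ℤ} {i j t : ℕ} (ht : i + j - 1 - q < t) {u v : V} (hu : u ∈ A.wt (i : ℤ))
    (hv : v ∈ A.wt (j : ℤ)) : A.cls (A.smear (onePlusPow ℂ p q) u v) ∈ A.filPred t := by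
  refine A.smear_mem ((A.filPred t).comap A.zhuO.mkQ) fun n hn => ?_
  have q_le : q ≤ n := not_lt.1 (mt coeff_onePlusPow_of_lt hn)
  have mode_mem := A.mode_mem_of_intCast hu hv n
  rw [← Int.cast_add] at mode_mem
  exact cls_mem_filPred hV0 (by lia) mode_mem

theorem zhuMul_mem_fil (hV0 : A.part 0 = ⨆ n : ℕ, A.wt (n : ℂ)) (s t : ℕ) (a b : A.Zhu)
    (ha : a ∈ A.fil s) (hb : b ∈ A.fil t) : A.zhuMul a b ∈ A.fil (s + t) := by
  suffices h : A.fil s ≤ (A.fil (s + t)).comap (A.zhuMul.flip b) from h ha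
  refine A.fil_le fun i hi u hu => ?_
  suffices h : A.fil t ≤ (A.fil (s + t)).comap (A.zhuMul (A.cls u)) from h hb
  refine A.fil_le fun j hj v hv => ?_
  rw [Submodule.mem_comap, zhuMul_cls, A.star_of_mem_intCast hu]
  exact cls_smear_onePlusPow_mem_filPred hV0 (t := s + t + 1) (by lia) hu hv

theorem zhuMul_sub_mem_filPred (hV0 : A.part 0 = ⨆ n : ℕ, A.wt (n : ℂ)) (s t : ℕ) (a b : A.Zhu)
    (ha : a ∈ A.fil s) (hb : b ∈ A.fil t) :
    A.zhuMul a b - A.zhuMul b a ∈ A.filPred (s + t) := by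
  suffices h : A.fil s ≤ (A.filPred (s + t)).comap (A.zhuMul.flip b - A.zhuMul b) from h ha
  refine A.fil_le fun i hi u hu => ?_
  suffices h : A.fil t ≤ (A.filPred (s + t)).comap (A.zhuMul (A.cls u) - A.zhuMul.flip (A.cls u))
    from h hb
  refine A.fil_le fun j hj v hv => ?_
  rw [Submodule.mem_comap, LinearMap.sub_apply, LinearMap.flip_apply, zhuMul_cls, zhuMul_cls,
    A.cls_star_eq_cls_rightStar v u, ← map_sub, A.star_sub_rightStar_of_mem_intCast hu]
  exact cls_smear_onePlusPow_mem_filPred hV0 (by lia) hu hv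

theorem zhuMul_isFilteredProduct (hV0 : A.part 0 = ⨆ n : ℕ, A.wt (n : ℂ)) :
    IsFilteredProduct A.fil A.filPred A.zhuMul where
  mul_mem := zhuMul_mem_fil hV0
  mul_mem_left s t a b ha hb := by
    cases s with
    | zero => simp [(Submodule.mem_bot ℂ).1 ha]
    | succ s =>
      rw [Nat.succ_add]
      exact zhuMul_mem_fil hV0 s t a b ha hb
  mul_mem_right s t a b ha hb := by
    cases t with
    | zero => simp [(Submodule.mem_bot ℂ).1 hb]
    | succ t => exact zhuMul_mem_fil hV0 s t a b ha hb

end CGradedVertexAlgebra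

open CGradedVertexAlgebra in
theorem mainTheorem8_general {V : Type*} [AddCommGroup V] [Module ℂ V] (A : CGradedVertexAlgebra V)
    (hV0 : A.part 0 = ⨆ n : ℕ, A.wt (n : ℂ)) :
    ∃ mul : A.Zhu →ₗ[ℂ] A.Zhu →ₗ[ℂ] A.Zhu,
      (∀ u v : V, mul (A.cls u) (A.cls v) = A.cls (A.star u v)) ∧
      (∀ a b c : A.Zhu, mul (mul a b) c = mul a (mul b c)) ∧
      (∀ a : A.Zhu, mul (A.cls A.vac) a = a ∧ mul a (A.cls A.vac) = a) ∧
      Monotone A.fil ∧ (⨆ t : ℕ, A.fil t) = ⊤ ∧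
      ∃ hmul : ∀ (s t : ℕ) (a b : A.Zhu), a ∈ A.fil s → b ∈ A.fil t → mul a b ∈ A.fil (s + t),
      ∃ grMul : A.gr →ₗ[ℂ] A.gr →ₗ[ℂ] A.gr,
        (∀ (s t : ℕ) (a : A.fil s) (b : A.fil t),
          grMul (A.symb s a) (A.symb t b) =
            A.symb (s + t) ⟨mul a b, hmul s t a b a.2 b.2⟩) ∧
        (∀ x y z : A.gr, grMul (grMul x y) z = grMul x (grMul y z)) ∧
        (∀ x y : A.gr, grMul x y = grMul y x) ∧
        (∀ x : A.gr, grMul (A.symb 0 ⟨A.cls A.vac, A.cls_vac_mem⟩) x = x) := by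
  have hmul := zhuMul_isFilteredProduct hV0
  exact ⟨A.zhuMul, A.zhuMul_cls, A.zhuMul_assoc, fun a => ⟨A.vac_zhuMul a, A.zhuMul_vac a⟩,
    A.fil_mono, iSup_fil hV0, hmul.mul_mem, AssociatedGraded.mul hmul,
    fun _ _ => AssociatedGraded.mul_symbol_symbol hmul,
    AssociatedGraded.mul_assoc hmul A.zhuMul_assoc,
    AssociatedGraded.mul_comm hmul (zhuMul_sub_mem_filPred hV0),
    AssociatedGraded.one_mul hmul A.cls_vac_mem A.vac_zhuMul⟩

theorem mainTheorem8 {V : Type*} [AddCommGroup V] [Module ℂ V] (A : CGradedVertexAlgebra V)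
    (hA : A.IsOmegaGeneratedReGraded)
    (hV0 : A.part 0 = ⨆ n : ℕ, A.wt (n : ℂ)) :
    -- `*` descends to `A(V)` and makes it an associative algebra with unit `[𝟏]`
    ∃ mul : A.Zhu →ₗ[ℂ] A.Zhu →ₗ[ℂ] A.Zhu,
      (∀ u v : V, mul (A.cls u) (A.cls v) = A.cls (A.star u v)) ∧
      (∀ a b c : A.Zhu, mul (mul a b) c = mul a (mul b c)) ∧
      (∀ a : A.Zhu, mul (A.cls A.vac) a = a ∧ mul a (A.cls A.vac) = a) ∧
      -- `F_t A(V)` is an increasing exhaustive filtration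
      Monotone A.fil ∧ (⨆ t : ℕ, A.fil t) = ⊤ ∧
      -- it is multiplicative
      ∃ hmul : ∀ (s t : ℕ) (a b : A.Zhu), a ∈ A.fil s → b ∈ A.fil t → mul a b ∈ A.fil (s + t),
      -- the induced product on `gr A(V)` is well defined, associative, commutative and unital
      ∃ grMul : A.gr →ₗ[ℂ] A.gr →ₗ[ℂ] A.gr,
        (∀ (s t : ℕ) (a : A.fil s) (b : A.fil t),
          grMul (A.symb s a) (A.symb t b) =
            A.symb (s + t) ⟨mul a b, hmul s t a b a.2 b.2⟩) ∧
        (∀ x y z : A.gr, grMul (grMul x y) z = grMul x (grMul y z)) ∧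
        (∀ x y : A.gr, grMul x y = grMul y x) ∧
        (∀ x : A.gr, grMul (A.symb 0 ⟨A.cls A.vac, A.cls_vac_mem⟩) x = x) :=
  mainTheorem8_general A hV0
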